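/- Let \(K\ge 1\) and \(n_k \ge r_k \ge 1\) (\(k=1,\dots,K\)) be integers, \(n=n_1\cdots n_K\), \(r=r_1\cdots r_K\). Let \(\mathcal V_{r_k,n_k}\) be the Stiefel manifold of \(n_k\times r_k\) real matrices with orthonormal columns, \(\mathcal O_{m}\) the group of orthogonal \(m\times m\) matrices, \(\mathcal U=\{U_K\otimes\cdots\otimes U_1 : U_k\in\mathcal V_{r_k,n_k}\}\) and \(\mathcal W=\{W_K\otimes\cdots\otimes W_1 : W_k\in\mathcal O_{n_k}\}\). For a known vector \(s\in\mathbb R^r\), consider the model \(y=\sigma U s+\sigma e\), \(e\sim N_n(0,I)\), with parameter \(\theta=(\sigma,U)\in\Theta=(0,\infty)\times\mathcal U\) and density \(p(y\mid\theta)\), the density of \(N_n(\sigma Us,\sigma^2 I)\). The group \(G=(0,\infty)\times\mathcal W\) acts on data by \((a,W)\cdot y=aWy\) and on parameters by \((a,W)\cdot(\sigma,U)=(a\sigma,WU)\). Let \(D\) be a measurable space (of decisions) on which \(G\) acts, and let \(L:D\times\Theta\to[0,\infty]\) be a measurable invariant loss: \(L(g\cdot d,g\cdot\theta)=L(d,\theta)\)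 for all \(g,d,\theta\). An equivariant decision rule is a measurable map \(\delta:\mathbb R^n\to D\) with \(\delta(g\cdot y)=g\cdot\delta(y)\) for all \(g\in G\) and \(y\neq0\). Its risk is \(R(\delta,\theta)=\mathbb E_\theta[L(\delta(y),\theta)]\), and it is a minimum risk equivariant rule if \(R(\delta,\theta)\le R(\delta',\theta)\) for every \(\theta\in\Theta\) and every equivariant decision rule \(\delta'\). Put \[ H(d,y)=\int_\Theta L(d,\theta)\,p(y\mid\theta)\,\pi_I(d\theta), \] where \(\pi_I=\pi_\sigma\times\pi_U\), \(\pi_\sigma(A)=\int_A\sigma^{-1}\,d\sigma\), and \(\pi_U\) is the law of \(U_K\otimes\cdots\otimes U_1\) when the \(U_k\) are independent and each \(U_k\) is uniformly distributed on \(\mathcal V_{r_k,n_k}\). Then: 1. Suppose that, for each \(y\ne0\), \(\delta(y)\) is the unique minimizer of \(H(\cdot,y)\) over \(D\). Then \(\delta(g\cdot y)=g\cdot\delta(y)\) for all \(g\in G\), \(y\neq 0\). If moreover \(\delta\) is measurable, then \(\delta\) is a minimum risk equivariant rule, and every minimum risk equivariant rule whose risk is finite at some \(\theta\) equals \(\delta\)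 for Lebesgue-almost every \(y\). 2. (Minimizers not assumed unique.) Every equivariant decision rule \(\delta\) such that \(\delta(y)\) minimizes \(H(\cdot,y)\) for almost every \(y\) is a minimum risk equivariant rule. 3. If a rule as in part 2 exists, then every minimum risk equivariant rule \(\delta'\) whose risk is finite at some \(\theta\) is such that \(\delta'(y)\) minimizes \(H(\cdot,y)\) for almost every \(y\). -/

import Mathlib

open MeasureTheory ProbabilityTheory
open scoped ENNReal NNReal Matrix

noncomputable section

namespace Tucker

/-- Real matrices carry the product (equivalently, Borel) sigma-algebra. -/
instance instMeasurableSpaceMatrix (m n : Type*) : MeasurableSpace (Matrix m n ℝ) :=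
  inferInstanceAs (MeasurableSpace (m → n → ℝ))

instance instBorelSpaceMatrix (m n : Type*) [Countable m] [Countable n] :
    BorelSpace (Matrix m n ℝ) :=
  inferInstanceAs (BorelSpace (m → n → ℝ))

instance instCompactSpaceOrthogonalGroup (n : ℕ) :
    CompactSpace (Matrix.orthogonalGroup (Fin n) ℝ) := by
  suffices h : IsCompact
      ((Matrix.orthogonalGroup (Fin n) ℝ : Submonoid _) : Set (Matrix (Fin n) (Fin n) ℝ)) from
    isCompact_iff_compactSpace.1 h
  have hK : IsCompact {A : Matrix (Fin n) (Fin n) ℝ | ∀ i j, A i j ∈ Set.Icc (-1 : ℝ) 1} := by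
    have h := isCompact_univ_pi (X := fun _ : Fin n => Fin n → ℝ)
      (s := fun _ => Set.univ.pi fun _ => Set.Icc (-1 : ℝ) 1)
      (fun _ => isCompact_univ_pi fun _ => isCompact_Icc)
    have heq : (Set.univ.pi fun _ : Fin n => Set.univ.pi fun _ : Fin n => Set.Icc (-1 : ℝ) 1)
        = {A : Fin n → Fin n → ℝ | ∀ i j, A i j ∈ Set.Icc (-1 : ℝ) 1} := by
      ext A
      exact ⟨fun h i j => h i trivial j trivial, fun h i _ j _ => h i j⟩
    rw [heq] at h
    exact h
  refine hK.of_isClosed_subset ?_ ?_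
  · have : ((Matrix.orthogonalGroup (Fin n) ℝ : Submonoid _) : Set (Matrix (Fin n) (Fin n) ℝ))
        = {A | A * star A = 1} := by
      ext A
      exact Matrix.mem_orthogonalGroup_iff (Fin n) ℝ
    rw [this]
    exact isClosed_eq (by fun_prop) continuous_const
  · intro A hA i j
    have := entry_norm_bound_of_unitary (𝕜 := ℝ) hA i j
    rwa [Real.norm_eq_abs, abs_le] at this

/-- The Stiefel manifold: `n × r` real matrices with orthonormal columns. -/
abbrev Stiefel (n r : ℕ) : Type := {U : Matrix (Fin n) (Fin r) ℝ // Uᵀ * U = 1}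

lemma orthogonal_mul_stiefel {n r : ℕ} (W : Matrix.orthogonalGroup (Fin n) ℝ)
    (U : Stiefel n r) : (W.1 * U.1)ᵀ * (W.1 * U.1) = 1 := by
  have hW : W.1ᵀ * W.1 = 1 := (Matrix.mem_orthogonalGroup_iff' (Fin n) ℝ).1 W.2
  rw [Matrix.transpose_mul, Matrix.mul_assoc, ← Matrix.mul_assoc W.1ᵀ, hW, Matrix.one_mul, U.2]

/-- The left action of the orthogonal group on the Stiefel manifold. -/
def rotate {n r : ℕ} (W : Matrix.orthogonalGroup (Fin n) ℝ) (U : Stiefel n r) : Stiefel n r :=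
  ⟨W.1 * U.1, orthogonal_mul_stiefel W U⟩

/-- The first `r` columns of an orthogonal matrix. -/
def firstColumns {n r : ℕ} (h : r ≤ n) (W : Matrix.orthogonalGroup (Fin n) ℝ) : Stiefel n r :=
  ⟨W.1.submatrix id (Fin.castLE h), by
    have hW : W.1ᵀ * W.1 = 1 := (Matrix.mem_orthogonalGroup_iff' (Fin n) ℝ).1 W.2
    ext i j
    have := congrFun (congrFun hW (Fin.castLE h i)) (Fin.castLE h j)
    simpa [Matrix.mul_apply, Matrix.one_apply] using this⟩

/-- The normalized Haar measure of the orthogonal group. -/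
def haarOrthogonal (n : ℕ) : Measure (Matrix.orthogonalGroup (Fin n) ℝ) :=
  Measure.haarMeasure ⊤

/-- The uniform distribution on the Stiefel manifold, that is, its (unique) probability measure
invariant under the orthogonal group: the law of the first `r` columns of a Haar-distributed
orthogonal matrix. -/
def uniformStiefel {n r : ℕ} (h : r ≤ n) : Measure (Stiefel n r) :=
  (haarOrthogonal n).map (firstColumns h)

lemma measurable_firstColumns {n r : ℕ} (h : r ≤ n) :
    Measurable (firstColumns h : _ → Stiefel n r) := by
  apply Continuous.measurable
  unfold firstColumns
  exact Continuous.subtype_mk (by fun_prop) _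

lemma measurable_rotate {n r : ℕ} (W : Matrix.orthogonalGroup (Fin n) ℝ) :
    Measurable (rotate W : Stiefel n r → Stiefel n r) := by
  apply Continuous.measurable
  unfold rotate
  exact Continuous.subtype_mk (by fun_prop) _

/-- The uniform distribution has total mass one. -/
instance instIsProbabilityMeasureUniformStiefel {n r : ℕ} (h : r ≤ n) :
    IsProbabilityMeasure (uniformStiefel h) := by
  have : IsProbabilityMeasure (haarOrthogonal n) :=
    ⟨Measure.haarMeasure_self
      (K₀ := (⊤ : TopologicalSpace.PositiveCompacts (Matrix.orthogonalGroup (Fin n) ℝ)))⟩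
  exact Measure.isProbabilityMeasure_map (measurable_firstColumns h).aemeasurable

/-- The uniform distribution is invariant under the orthogonal group. -/
lemma map_rotate_uniformStiefel {n r : ℕ} (h : r ≤ n) (W : Matrix.orthogonalGroup (Fin n) ℝ) :
    (uniformStiefel h).map (rotate W) = uniformStiefel h := by
  have hcomp : (rotate W : Stiefel n r → Stiefel n r) ∘ firstColumns h
      = firstColumns h ∘ (fun V => W * V) := by
    funext V
    apply Subtype.ext
    ext i j
    simp [rotate, firstColumns, Matrix.mul_apply]
  have hmul : Measurable (fun V : Matrix.orthogonalGroup (Fin n) ℝ => W * V) :=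
    (continuous_const_mul W).measurable
  have hinv : (haarOrthogonal n).map (fun V => W * V) = haarOrthogonal n :=
    map_mul_left_eq_self (Measure.haarMeasure ⊤) W
  unfold uniformStiefel
  rw [Measure.map_map (measurable_rotate W) (measurable_firstColumns h), hcomp,
    ← Measure.map_map (measurable_firstColumns h) hmul, hinv]

/-- The Kronecker product `A_K ⊗ ⋯ ⊗ A_1`. Entries of vectorized arrays are labelled by
multi-indices `(i_1, …, i_K)`, so that the entry at `(i, j)` is `∏ k, A_k (i k) (j k)`. -/
def kron {K : ℕ} {n m : Fin K → ℕ} (A : ∀ k, Matrix (Fin (n k)) (Fin (m k)) ℝ) :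
    Matrix (∀ k, Fin (n k)) (∀ k, Fin (m k)) ℝ :=
  Matrix.of fun i j => ∏ k, A k (i k) (j k)

lemma kron_mul {K : ℕ} {n m l : Fin K → ℕ} (A : ∀ k, Matrix (Fin (n k)) (Fin (m k)) ℝ)
    (B : ∀ k, Matrix (Fin (m k)) (Fin (l k)) ℝ) :
    kron A * kron B = kron fun k => A k * B k := by
  ext i j
  simp only [kron, Matrix.mul_apply, Matrix.of_apply, ← Finset.prod_mul_distrib]
  rw [Finset.prod_univ_sum, Fintype.piFinset_univ]

lemma kron_one {K : ℕ} {n : Fin K → ℕ} :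
    kron (fun k => (1 : Matrix (Fin (n k)) (Fin (n k)) ℝ)) = 1 := by
  ext i j
  simp only [kron, Matrix.of_apply, Matrix.one_apply]
  by_cases h : i = j
  · simp [h]
  · obtain ⟨k, hk⟩ := Function.ne_iff.1 h
    rw [if_neg h]
    exact Finset.prod_eq_zero (Finset.mem_univ k) (if_neg hk)

lemma kron_transpose {K : ℕ} {n m : Fin K → ℕ} (A : ∀ k, Matrix (Fin (n k)) (Fin (m k)) ℝ) :
    (kron A)ᵀ = kron fun k => (A k)ᵀ := rfl

/-- The homomorphism `(W_1, …, W_K) ↦ W_K ⊗ ⋯ ⊗ W_1` on orthogonal matrices. -/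
def kronHom {K : ℕ} (n : Fin K → ℕ) :
    (∀ k, Matrix.orthogonalGroup (Fin (n k)) ℝ) →*
      Matrix.orthogonalGroup (∀ k, Fin (n k)) ℝ where
  toFun W := ⟨kron fun k => (W k).1, by
    rw [Matrix.mem_orthogonalGroup_iff]
    rw [kron_transpose, kron_mul, ← kron_one]
    congr 1
    funext k
    exact (Matrix.mem_orthogonalGroup_iff (Fin (n k)) ℝ).1 (W k).2⟩
  map_one' := Subtype.ext kron_one
  map_mul' V W := Subtype.ext (kron_mul (fun k => (V k).1) (fun k => (W k).1)).symm

/-- The group of Kronecker products of orthogonal matrices. -/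
abbrev KronOrthogonal {K : ℕ} (n : Fin K → ℕ) :
    Subgroup (Matrix.orthogonalGroup (∀ k, Fin (n k)) ℝ) :=
  (kronHom n).range

/-- The set of Kronecker products `U_K ⊗ ⋯ ⊗ U_1` of Stiefel matrices. -/
def factorSet {K : ℕ} (n r : Fin K → ℕ) : Set (Matrix (∀ k, Fin (n k)) (∀ k, Fin (r k)) ℝ) :=
  Set.range fun U : (∀ k, Stiefel (n k) (r k)) => kron fun k => (U k).1

/-- The parameter space of pairs `θ = (σ, U)`, with `σ > 0` and `U` a Kronecker product of
Stiefel matrices. -/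
abbrev Param {K : ℕ} (n r : Fin K → ℕ) : Type := {σ : ℝ // 0 < σ} × factorSet n r

/-- Vectorized `n_1 × ⋯ × n_K` arrays. -/
abbrev Vec {K : ℕ} (n : Fin K → ℕ) : Type := (∀ k, Fin (n k)) → ℝ

/-- The group of pairs `(a, W)`, with `a > 0` and `W` a Kronecker product of orthogonal
matrices. -/
abbrev TransGroup {K : ℕ} (n : Fin K → ℕ) : Type := {a : ℝ // 0 < a} × KronOrthogonal n

/-- The action `y ↦ a W y` on data. -/
def actData {K : ℕ} {n : Fin K → ℕ} (g : TransGroup n) (y : Vec n) : Vec n :=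
  g.1.1 • (g.2.1.1 *ᵥ y)

/-- The induced action `(σ, U) ↦ (a σ, W U)` on parameters. -/
def actParam {K : ℕ} {n r : Fin K → ℕ} (g : TransGroup n) (θ : Param n r) : Param n r :=
  (g.1 * θ.1, ⟨g.2.1.1 * θ.2.1, by
    obtain ⟨-, ⟨W, hW⟩⟩ := g.2
    obtain ⟨-, ⟨U, rfl⟩⟩ := θ.2
    subst hW
    exact ⟨fun k => rotate (W k) (U k), (kron_mul (fun k => (W k).1) (fun k => (U k).1)).symm⟩⟩)

/-- The law of `y = σ U s + σ e`, where `e` has independent standard normal entries. -/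
def dataLaw {K : ℕ} {n r : Fin K → ℕ} (s : Vec r) (θ : Param n r) : Measure (Vec n) :=
  (Measure.pi fun _ => gaussianReal 0 1).map fun e => θ.1.1 • (θ.2.1 *ᵥ s) + θ.1.1 • e

/-- The normal density `p(y | θ)`, with mean `σ U s` and covariance `σ² I`. -/
def density {K : ℕ} {n r : Fin K → ℕ} (s : Vec r) (θ : Param n r) (y : Vec n) : ℝ≥0∞ :=
  ∏ i, gaussianPDF (θ.1.1 * (θ.2.1 *ᵥ s) i) ⟨θ.1.1 ^ 2, sq_nonneg _⟩ (y i)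

/-- The measure `dσ / σ` on the positive reals. -/
def scalePrior : Measure {σ : ℝ // 0 < σ} :=
  (Measure.comap Subtype.val volume).withDensity fun σ => ENNReal.ofReal (σ.1⁻¹)

/-- The law of `U_K ⊗ ⋯ ⊗ U_1` for independent `U_k`, each uniform on its Stiefel manifold. -/
def factorPrior {K : ℕ} {n r : Fin K → ℕ} (hrn : ∀ k, r k ≤ n k) : Measure (factorSet n r) :=
  (Measure.pi fun k => uniformStiefel (hrn k)).map fun U =>
    (⟨kron fun k => (U k).1, U, rfl⟩ : factorSet n r)

/-- The prior `π_I`, the product of `dσ / σ` and the law of `U`. -/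
def invariantPrior {K : ℕ} {n r : Fin K → ℕ} (hrn : ∀ k, r k ≤ n k) : Measure (Param n r) :=
  scalePrior.prod (factorPrior hrn)

/-- `∫ L(d, θ) p(y | θ) π_I(dθ)`. -/
def bayesLoss {K : ℕ} {n r : Fin K → ℕ} (hrn : ∀ k, r k ≤ n k) (s : Vec r) {D : Type*}
    (L : D → Param n r → ℝ≥0∞) (y : Vec n) (d : D) : ℝ≥0∞ :=
  ∫⁻ θ, L d θ * density s θ y ∂(invariantPrior hrn)

/-- The risk `E[L(δ(y), θ) | θ]` of a decision rule. -/
def risk {K : ℕ} {n r : Fin K → ℕ} (s : Vec r) {D : Type*}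
    (L : D → Param n r → ℝ≥0∞) (δ : Vec n → D) (θ : Param n r) : ℝ≥0∞ :=
  ∫⁻ y, L (δ y) θ ∂(dataLaw s θ)

/-- `δ(g y) = g δ(y)` for all `g` and all `y ≠ 0`. (The origin, a null set, is left out of the
sample space.) -/
def Equivariant {K : ℕ} {n : Fin K → ℕ} {D : Type*} [MulAction (TransGroup n) D]
    (δ : Vec n → D) : Prop :=
  ∀ (g : TransGroup n) (y : Vec n), y ≠ 0 → δ (actData g y) = g • δ y

/-- `δ` is an equivariant decision rule that has, at every parameter value, the least risk among
all equivariant decision rules. -/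
def IsMinRiskEquivariant {K : ℕ} {n r : Fin K → ℕ} (s : Vec r) {D : Type*} [MeasurableSpace D]
    [MulAction (TransGroup n) D] (L : D → Param n r → ℝ≥0∞) (δ : Vec n → D) : Prop :=
  Measurable δ ∧ Equivariant δ ∧
    ∀ δ' : Vec n → D, Measurable δ' → Equivariant δ' → ∀ θ, risk s L δ θ ≤ risk s L δ' θ

end Tucker

end

/-!
The group `G` of pairs `(a, W)` acts transitively on the parameters, and the prior `π_I` is
invariant under it. Hence the Bayes loss `H` satisfies `H(g d, g y) = a ^ (-n) H(d, y)`
(`bayesLoss_smul`), which makes a unique minimizer equivariant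
(`equivariant_of_unique_minimizer`).

The link between Bayes loss and risk is the identity

  `∫ H(δ(y), y) w(|y|) dy = R(δ, θ)`  for every equivariant rule `δ` and every `θ`,

where `w > 0` is any weight with `∫ w(a) da / a = 1`; here `w(x) = x e⁻ˣ`
(`lintegral_bayesLoss_eq_risk`). By Tonelli's theorem the left side is the integral over the
parameters `g θ` of `∫ L(δ(y), g θ) p(y | g θ) w(|y|) dy`. The substitution `y = g z` turns the
latter into `∫ L(δ(z), θ) p(z | θ) w(a |z|) dz`, and integrating out the scale removes the weight.
No Haar measure on `G` is needed: the inner integral depends on `g` through its scale only, and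
the law of `U` is a probability measure.

Thus a rule that minimizes `H(·, y)` for almost every `y` minimizes the risk, and if another
equivariant rule attains the same finite risk, positivity of `w` forces the two Bayes losses to
agree almost everywhere (`ae_bayesLoss_eq_of_isMinRiskEquivariant`).
-/

namespace Tucker

variable {K : ℕ} {n r : Fin K → ℕ}

/-! ### The group action -/

lemma dotProduct_orthogonal_mulVec {ι : Type*} [Fintype ι] [DecidableEq ι]
    (W : Matrix.orthogonalGroup ι ℝ) (x y : ι → ℝ) : (W.1 *ᵥ x) ⬝ᵥ (W.1 *ᵥ y) = x ⬝ᵥ y := by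
  rw [Matrix.dotProduct_mulVec, Matrix.vecMul_mulVec,
    (Matrix.mem_orthogonalGroup_iff' ι ℝ).1 W.2, Matrix.vecMul_one]

lemma actData_dotProduct_self (g : TransGroup n) (y : Vec n) :
    actData g y ⬝ᵥ actData g y = g.1.1 ^ 2 * (y ⬝ᵥ y) := by
  simp only [actData, smul_dotProduct, dotProduct_smul, smul_eq_mul,
    dotProduct_orthogonal_mulVec]
  ring

lemma actData_ne_zero (g : TransGroup n) {y : Vec n} (hy : y ≠ 0) : actData g y ≠ 0 := by
  intro h
  have h' := actData_dotProduct_self g y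
  rw [h, zero_dotProduct, eq_comm, mul_eq_zero, dotProduct_self_eq_zero] at h'
  exact h'.elim (pow_ne_zero 2 g.1.2.ne') hy

lemma measurable_actData (g : TransGroup n) : Measurable (actData g) := by
  apply Continuous.measurable
  unfold actData
  fun_prop

lemma actData_mean (g : TransGroup n) (s : Vec r) (θ : Param n r) :
    (actParam g θ).1.1 • ((actParam g θ).2.1 *ᵥ s) = actData g (θ.1.1 • (θ.2.1 *ᵥ s)) := by
  simp only [actParam, actData, Positive.val_mul, ← Matrix.mulVec_mulVec, Matrix.mulVec_smul,
    smul_smul]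

lemma actData_sub (g : TransGroup n) (x y : Vec n) :
    actData g (x - y) = actData g x - actData g y := by
  simp only [actData, Matrix.mulVec_sub, smul_sub]

lemma map_actData_volume (g : TransGroup n) :
    (volume : Measure (Vec n)).map (actData g)
      = ENNReal.ofReal ((g.1.1 ^ Fintype.card (∀ k, Fin (n k)))⁻¹) • volume := by
  have hW : |g.2.1.1.det| = 1 := by
    have h := congrArg Matrix.det ((Matrix.mem_orthogonalGroup_iff _ ℝ).1 g.2.1.2)
    rw [Matrix.det_mul, Matrix.det_transpose, Matrix.det_one, ← sq, ← sq_abs] at h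
    exact (pow_eq_one_iff_of_nonneg (abs_nonneg _) two_ne_zero).1 h
  have hdet : |(g.1.1 • g.2.1.1).det| = g.1.1 ^ Fintype.card (∀ k, Fin (n k)) := by
    rw [Matrix.det_smul, abs_mul, hW, mul_one, abs_of_pos (pow_pos g.1.2 _)]
  have hne : (g.1.1 • g.2.1.1).det ≠ 0 := by
    rw [← abs_pos, hdet]
    exact pow_pos g.1.2 _
  have h := Real.map_matrix_volume_pi_eq_smul_volume_pi hne
  rw [abs_inv, hdet] at h
  rw [← h]
  congr 1
  funext y
  simp [actData, Matrix.toLin'_apply]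

/-- The orthogonal group acts transitively on the Stiefel manifold. -/
lemma exists_rotate_eq {m q : ℕ} (U V : Stiefel m q) :
    ∃ W : Matrix.orthogonalGroup (Fin m) ℝ, rotate W U = V := by
  -- Both matrices are completed to orthogonal ones, `U'` and `V'`; then `W = V' U'⁻¹`.
  have complete (hqm : q ≤ m) (U : Stiefel m q) :
      ∃ W : Matrix.orthogonalGroup (Fin m) ℝ, firstColumns hqm W = U := by
    let v : Fin m → EuclideanSpace ℝ (Fin m) := fun j =>
      WithLp.toLp 2 fun i => if h : j.1 < q then U.1 i ⟨j.1, h⟩ else 0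
    have hU := U.2
    have hv : Orthonormal ℝ (Set.domRestrict {j : Fin m | j.1 < q} v) := by
      rw [orthonormal_iff_ite]
      rintro ⟨i, hi⟩ ⟨j, hj⟩
      have hi' : i.1 < q := hi
      have hj' : j.1 < q := hj
      have h := congrFun (congrFun hU ⟨i, hi'⟩) ⟨j, hj'⟩
      simp only [Matrix.mul_apply, Matrix.transpose_apply, Matrix.one_apply, Fin.mk.injEq] at h
      simp only [Set.domRestrict_apply, v, PiLp.inner_apply, hi', hj', dif_pos, RCLike.inner_apply,
        conj_trivial, Subtype.mk.injEq, Fin.ext_iff]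
      rw [← h]
      exact Finset.sum_congr rfl fun _ _ => mul_comm _ _
    obtain ⟨b, hb⟩ := hv.exists_orthonormalBasis_extension_of_card_eq (by simp)
    refine ⟨⟨Matrix.of fun i j => b j i, ?_⟩, ?_⟩
    · rw [Matrix.mem_orthogonalGroup_iff']
      ext i j
      have h := orthonormal_iff_ite.1 b.orthonormal i j
      simp only [PiLp.inner_apply, RCLike.inner_apply, conj_trivial] at h
      simp only [Matrix.mul_apply, Matrix.of_apply, Matrix.one_apply]
      rw [← h]
      exact Finset.sum_congr rfl fun _ _ => mul_comm _ _
    · apply Subtype.ext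
      ext i j
      have hj : (Fin.castLE hqm j) ∈ {j : Fin m | j.1 < q} := j.2
      simp [firstColumns, hb _ hj, v]
  -- Orthonormal columns are linearly independent, so there are at most `m` of them.
  have hqm : q ≤ m := by
    have h : Function.Injective U.1.mulVecLin := by
      intro x y hxy
      have h := congrArg (U.1ᵀ *ᵥ ·) hxy
      simpa [Matrix.mulVec_mulVec, U.2] using h
    simpa using LinearMap.finrank_le_finrank_of_injective h
  obtain ⟨U', rfl⟩ := complete hqm U
  obtain ⟨V', rfl⟩ := complete hqm V
  refine ⟨V' * U'⁻¹, ?_⟩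
  have hcomp (W : Matrix.orthogonalGroup (Fin m) ℝ) :
      rotate W (firstColumns hqm U') = firstColumns hqm (W * U') := by
    apply Subtype.ext
    ext i j
    simp [rotate, firstColumns, Matrix.mul_apply]
  rw [hcomp, inv_mul_cancel_right]

/-- The group acts transitively on the parameters, and the scale of the group element is determined
by the scales of the two parameters. -/
lemma exists_actParam_eq (θ θ' : Param n r) :
    ∃ g : TransGroup n, g.1 = θ'.1 * θ.1⁻¹ ∧ actParam g θ = θ' := by
  obtain ⟨σ, ⟨_, U, rfl⟩⟩ := θ
  obtain ⟨σ', ⟨_, U', rfl⟩⟩ := θ'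
  choose W hW using fun k => exists_rotate_eq (U k) (U' k)
  refine ⟨(σ' * σ⁻¹, ⟨kronHom n W, W, rfl⟩), rfl, ?_⟩
  refine Prod.ext (inv_mul_cancel_right σ' σ) (Subtype.ext ?_)
  change kron (fun k => (W k).1) * kron (fun k => (U k).1) = kron fun k => (U' k).1
  rw [kron_mul]
  congr 1
  funext k
  exact congrArg Subtype.val (hW k)

/-! ### The invariant prior -/

lemma measurable_kron_stiefel :
    Measurable fun U : (∀ k, Stiefel (n k) (r k)) =>
      (⟨kron fun k => (U k).1, U, rfl⟩ : factorSet n r) := by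
  refine Measurable.subtype_mk ?_
  refine measurable_pi_lambda _ fun i => measurable_pi_lambda _ fun j => ?_
  change Measurable fun U : (∀ k, Stiefel (n k) (r k)) => ∏ k, (U k).1 (i k) (j k)
  refine Finset.measurable_fun_prod _ fun k _ => ?_
  have h : Measurable fun A : Matrix (Fin (n k)) (Fin (r k)) ℝ => A (i k) (j k) :=
    (measurable_pi_apply (j k)).comp (measurable_pi_apply (i k))
  exact h.comp (measurable_subtype_coe.comp (measurable_pi_apply k))

instance instIsProbabilityMeasureFactorPrior (hrn : ∀ k, r k ≤ n k) :
    IsProbabilityMeasure (factorPrior hrn) :=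
  Measure.isProbabilityMeasure_map measurable_kron_stiefel.aemeasurable

lemma measurableEmbedding_coe_pos :
    MeasurableEmbedding (Subtype.val : {σ : ℝ // 0 < σ} → ℝ) :=
  MeasurableEmbedding.subtype_coe measurableSet_Ioi

lemma lintegral_scalePrior (f : ℝ → ℝ≥0∞) :
    ∫⁻ a, f a.1 ∂scalePrior = ∫⁻ x in Set.Ioi 0, ENNReal.ofReal x⁻¹ * f x := by
  rw [scalePrior, lintegral_withDensity_eq_lintegral_mul_non_measurable₀]
  · exact lintegral_subtype_comap measurableSet_Ioi fun x => ENNReal.ofReal x⁻¹ * f x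
  · exact (measurable_subtype_coe.inv.ennreal_ofReal).aemeasurable
  · exact Filter.Eventually.of_forall fun _ => ENNReal.ofReal_lt_top

instance instSigmaFiniteScalePrior : SigmaFinite scalePrior := by
  have : SigmaFinite (Measure.comap (Subtype.val : {σ : ℝ // 0 < σ} → ℝ) volume) :=
    SigmaFinite.of_map _ measurable_subtype_coe.aemeasurable (by
      rw [measurableEmbedding_coe_pos.map_comap]
      infer_instance)
  exact SigmaFinite.withDensity_ofReal _

lemma lintegral_mul_scalePrior (c : {σ : ℝ // 0 < σ}) (f : ℝ → ℝ≥0∞) (hf : Measurable f) :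
    ∫⁻ a, f (c * a).1 ∂scalePrior = ∫⁻ a, f a.1 ∂scalePrior := by
  have hc := c.2
  let F : ℝ → ℝ≥0∞ := (Set.Ioi 0).indicator fun x => ENNReal.ofReal x⁻¹ * f x
  have hF : Measurable F := by
    refine Measurable.indicator ?_ measurableSet_Ioi
    fun_prop
  simp only [Positive.val_mul]
  rw [lintegral_scalePrior f, lintegral_scalePrior fun x => f (c.1 * x),
    ← lintegral_indicator measurableSet_Ioi, ← lintegral_indicator measurableSet_Ioi]
  have hvol : ∫⁻ x, F (c.1 * x) = ENNReal.ofReal c.1⁻¹ * ∫⁻ x, F x := by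
    rw [← lintegral_map hF (measurable_const_mul c.1), Real.map_volume_mul_left hc.ne',
      lintegral_smul_measure, abs_of_pos (inv_pos.2 hc), smul_eq_mul]
  have hF' (x : ℝ) : (Set.Ioi 0).indicator (fun x => ENNReal.ofReal x⁻¹ * f (c.1 * x)) x
      = ENNReal.ofReal c.1 * F (c.1 * x) := by
    by_cases hx : 0 < x
    · have hcx : 0 < c.1 * x := mul_pos hc hx
      simp only [F]
      rw [Set.indicator_of_mem (Set.mem_Ioi.2 hx), Set.indicator_of_mem (Set.mem_Ioi.2 hcx),
        ← mul_assoc, ← ENNReal.ofReal_mul hc.le]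
      congr 2
      field_simp
    · have hcx : ¬ 0 < c.1 * x := fun h => hx (pos_of_mul_pos_right h hc.le)
      simp only [F]
      rw [Set.indicator_of_notMem (by simpa using hx),
        Set.indicator_of_notMem (by simpa using hcx), mul_zero]
  simp only [hF']
  have hFc : Measurable fun x => F (c.1 * x) := hF.comp (measurable_const_mul c.1)
  rw [lintegral_const_mul _ hFc, hvol, ← mul_assoc,
    ← ENNReal.ofReal_mul hc.le, mul_inv_cancel₀ hc.ne', ENNReal.ofReal_one, one_mul]

lemma map_mul_scalePrior (c : {σ : ℝ // 0 < σ}) : scalePrior.map (c * ·) = scalePrior := by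
  have hm : Measurable (c * · : {σ : ℝ // 0 < σ} → _) :=
    Measurable.subtype_mk (measurable_subtype_coe.const_mul c.1)
  ext S hS
  let f : ℝ → ℝ≥0∞ := (Subtype.val '' S).indicator 1
  have hf : Measurable f :=
    measurable_one.indicator (measurableEmbedding_coe_pos.measurableSet_image.2 hS)
  have hfS (a : {σ : ℝ // 0 < σ}) : f a.1 = S.indicator 1 a := by
    simp only [f, Set.indicator, Pi.one_apply]
    congr 1
    exact propext Subtype.val_injective.mem_set_image
  have h := lintegral_mul_scalePrior c f hf
  simp only [hfS] at h
  rwa [← lintegral_map (measurable_one.indicator hS) hm, lintegral_indicator_one hS,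
    lintegral_indicator_one hS] at h

lemma map_actParam_invariantPrior (hrn : ∀ k, r k ≤ n k) (g : TransGroup n) :
    (invariantPrior hrn).map (actParam (r := r) g) = invariantPrior hrn := by
  obtain ⟨a, ⟨_, W, rfl⟩⟩ := g
  let T : factorSet n r → factorSet n r :=
    fun U => (actParam (a, ⟨kronHom n W, W, rfl⟩) (a, U)).2
  have hT : Measurable T := by
    apply Continuous.measurable
    exact Continuous.subtype_mk (continuous_const.matrix_mul continuous_subtype_val) _
  have hm : Measurable (a * · : {σ : ℝ // 0 < σ} → _) :=
    Measurable.subtype_mk (measurable_subtype_coe.const_mul a.1)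
  have hTU : T ∘ (fun U : (∀ k, Stiefel (n k) (r k)) =>
        (⟨kron fun k => (U k).1, U, rfl⟩ : factorSet n r))
      = (fun U : (∀ k, Stiefel (n k) (r k)) =>
        (⟨kron fun k => (U k).1, U, rfl⟩ : factorSet n r)) ∘ fun U k => rotate (W k) (U k) := by
    funext U
    exact Subtype.ext (kron_mul (fun k => (W k).1) (fun k => (U k).1))
  have hrot : Measurable fun (U : ∀ k, Stiefel (n k) (r k)) k => rotate (W k) (U k) :=
    measurable_pi_lambda _ fun k => (measurable_rotate (W k)).comp (measurable_pi_apply k)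
  have hfac : (factorPrior hrn).map T = factorPrior hrn := by
    have hs : ∀ k, SigmaFinite ((uniformStiefel (hrn k)).map (rotate (W k))) := fun k => by
      rw [map_rotate_uniformStiefel]
      infer_instance
    rw [factorPrior, Measure.map_map hT measurable_kron_stiefel, hTU,
      ← Measure.map_map measurable_kron_stiefel hrot,
      Measure.pi_map_pi fun k => (measurable_rotate (W k)).aemeasurable]
    simp only [map_rotate_uniformStiefel]
  have h := Measure.map_prod_map scalePrior (factorPrior hrn) hm hT
  rw [map_mul_scalePrior, hfac] at h
  exact h.symm

lemma measurable_actParam (g : TransGroup n) : Measurable (actParam (r := r) g) := by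
  refine Measurable.prodMk ?_ ?_
  · exact Measurable.subtype_mk ((measurable_subtype_coe.comp measurable_fst).const_mul g.1.1)
  · refine Measurable.subtype_mk ?_
    have h : Continuous fun A : Matrix (∀ k, Fin (n k)) (∀ k, Fin (r k)) ℝ => g.2.1.1 * A :=
      continuous_const.matrix_mul continuous_id
    exact h.measurable.comp (measurable_subtype_coe.comp measurable_snd)

/-! ### The normal density -/

lemma pi_withDensity_ofReal {ι : Type*} [Fintype ι] (f : ι → ℝ → ℝ) (hf : ∀ i x, 0 ≤ f i x)
    (hint : ∀ i, Integrable (f i)) :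
    Measure.pi (fun i => volume.withDensity fun x => ENNReal.ofReal (f i x))
      = (volume : Measure (ι → ℝ)).withDensity fun y => ∏ i, ENNReal.ofReal (f i (y i)) := by
  have hfin (i : ι) : IsFiniteMeasure (volume.withDensity fun x => ENNReal.ofReal (f i x)) :=
    isFiniteMeasure_withDensity_ofReal (hint i).2
  refine Measure.pi_eq fun t ht => ?_
  simp only [← ENNReal.ofReal_prod_of_nonneg fun i _ => hf i _]
  rw [withDensity_apply _ (MeasurableSet.univ_pi ht), volume_pi, Measure.restrict_pi_pi,
    ← ofReal_integral_eq_lintegral_ofReal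
      (Integrable.fintype_prod_dep fun i => (hint i).restrict)
      (Filter.Eventually.of_forall fun y => Finset.prod_nonneg fun i _ => hf i (y i)),
    integral_fintype_prod_eq_prod,
    ENNReal.ofReal_prod_of_nonneg fun i _ => integral_nonneg (hf i)]
  refine Finset.prod_congr rfl fun i _ => ?_
  rw [withDensity_apply _ (ht i), ofReal_integral_eq_lintegral_ofReal (hint i).restrict
    (Filter.Eventually.of_forall (hf i))]

lemma dataLaw_eq_withDensity (s : Vec r) (θ : Param n r) :
    dataLaw s θ = volume.withDensity (density s θ) := by
  have hσ := θ.1.2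
  have hv : NNReal.mk (θ.1.1 ^ 2) (sq_nonneg _) ≠ 0 := by
    rw [← NNReal.coe_ne_zero]
    exact pow_ne_zero 2 hσ.ne'
  have hm (i : ∀ k, Fin (n k)) :
      Measurable fun x : ℝ => θ.1.1 * (θ.2.1 *ᵥ s) i + θ.1.1 * x := by fun_prop
  have hgauss (i : ∀ k, Fin (n k)) :
      (gaussianReal 0 1).map (fun x : ℝ => θ.1.1 * (θ.2.1 *ᵥ s) i + θ.1.1 * x)
        = volume.withDensity fun x => ENNReal.ofReal
          (gaussianPDFReal (θ.1.1 * (θ.2.1 *ᵥ s) i) (.mk (θ.1.1 ^ 2) (sq_nonneg _)) x) := by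
    have h : (fun x : ℝ => θ.1.1 * (θ.2.1 *ᵥ s) i + θ.1.1 * x)
        = (θ.1.1 * (θ.2.1 *ᵥ s) i + ·) ∘ (θ.1.1 * ·) := rfl
    rw [h, ← Measure.map_map (measurable_const_add _) (measurable_const_mul _),
      gaussianReal_map_const_mul, gaussianReal_map_const_add, mul_zero, zero_add, mul_one]
    exact gaussianReal_of_var_ne_zero _ hv
  have hsf (i : ∀ k, Fin (n k)) : SigmaFinite
      ((gaussianReal 0 1).map (fun x : ℝ => θ.1.1 * (θ.2.1 *ᵥ s) i + θ.1.1 * x)) := by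
    have := Measure.isProbabilityMeasure_map (μ := gaussianReal 0 1) (hm i).aemeasurable
    infer_instance
  calc dataLaw s θ
      = Measure.pi fun i =>
          (gaussianReal 0 1).map (fun x : ℝ => θ.1.1 * (θ.2.1 *ᵥ s) i + θ.1.1 * x) :=
        Measure.pi_map_pi (μ := fun _ => gaussianReal 0 1) fun i => (hm i).aemeasurable
    _ = volume.withDensity (density s θ) := by
        simp only [hgauss]
        exact pi_withDensity_ofReal _ (fun i => gaussianPDFReal_nonneg _ _)
          fun i => integrable_gaussianPDFReal _ _

lemma density_eq (s : Vec r) (θ : Param n r) (y : Vec n) :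
    density s θ y = ENNReal.ofReal
      ((√(2 * Real.pi * θ.1.1 ^ 2))⁻¹ ^ Fintype.card (∀ k, Fin (n k)) *
        Real.exp (-((y - θ.1.1 • (θ.2.1 *ᵥ s)) ⬝ᵥ (y - θ.1.1 • (θ.2.1 *ᵥ s)))
          / (2 * θ.1.1 ^ 2))) := by
  change ∏ i, ENNReal.ofReal (gaussianPDFReal (θ.1.1 * (θ.2.1 *ᵥ s) i)
    (.mk (θ.1.1 ^ 2) (sq_nonneg _)) (y i)) = _
  rw [← ENNReal.ofReal_prod_of_nonneg fun i _ => gaussianPDFReal_nonneg _ _ _]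
  congr 1
  simp only [gaussianPDFReal, Finset.prod_mul_distrib, Finset.prod_const, ← Real.exp_sum,
    ← Finset.sum_div, Finset.sum_neg_distrib, NNReal.coe_mk, Finset.card_univ]
  congr 5
  funext i
  exact sq _

lemma density_actData (s : Vec r) (g : TransGroup n) (θ : Param n r) (y : Vec n) :
    density s (actParam g θ) (actData g y)
      = ENNReal.ofReal ((g.1.1 ^ Fintype.card (∀ k, Fin (n k)))⁻¹) * density s θ y := by
  have ha := g.1.2
  have hσ : (actParam g θ).1.1 = g.1.1 * θ.1.1 := rfl
  rw [density_eq, density_eq, actData_mean, ← actData_sub, actData_dotProduct_self, hσ,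
    ← ENNReal.ofReal_mul (by positivity), ← mul_assoc, ← inv_pow, ← mul_pow]
  congr 2
  · congr 1
    rw [← mul_inv, mul_pow, mul_left_comm, Real.sqrt_mul (sq_nonneg _), Real.sqrt_sq ha.le]
  · have := ha.ne'
    have := θ.1.2.ne'
    congr 1
    field_simp

lemma measurable_density (s : Vec r) :
    Measurable (Function.uncurry (density (n := n) s)) := by
  have hσ : Measurable fun p : Param n r × Vec n => p.1.1.1 :=
    measurable_subtype_coe.comp (measurable_fst.comp measurable_fst)
  have hU (i : ∀ k, Fin (n k)) (j : ∀ k, Fin (r k)) :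
      Measurable fun p : Param n r × Vec n => p.1.2.1 i j :=
    (measurable_pi_apply j).comp ((measurable_pi_apply i).comp
      (measurable_subtype_coe.comp (measurable_snd.comp measurable_fst)))
  have hres (i : ∀ k, Fin (n k)) : Measurable fun p : Param n r × Vec n =>
      (p.2 - p.1.1.1 • (p.1.2.1 *ᵥ s)) i := by
    have hmul : Measurable fun p : Param n r × Vec n => ∑ j, p.1.2.1 i j * s j :=
      Finset.measurable_fun_sum _ fun j _ => (hU i j).mul_const _
    have hy : Measurable fun p : Param n r × Vec n => p.2 i :=
      (measurable_pi_apply i).comp measurable_snd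
    exact hy.sub (hσ.mul hmul)
  have hsq : Measurable fun p : Param n r × Vec n =>
      (p.2 - p.1.1.1 • (p.1.2.1 *ᵥ s)) ⬝ᵥ (p.2 - p.1.1.1 • (p.1.2.1 *ᵥ s)) :=
    Finset.measurable_fun_sum _ fun i _ => (hres i).mul (hres i)
  have hdens : Function.uncurry (density (n := n) s) = fun p => _ :=
    funext fun p => density_eq s p.1 p.2
  rw [hdens]
  have hconst := ((((hσ.pow_const 2).const_mul (2 * Real.pi)).sqrt).inv).pow_const
    (Fintype.card (∀ k, Fin (n k)))
  exact (hconst.mul (hsq.neg.div ((hσ.pow_const 2).const_mul 2)).exp).ennreal_ofReal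

/-- The Euclidean length `|y|` of the data. (The norm of the type `Vec n` is the maximum norm, which
orthogonal matrices do not preserve.) -/
noncomputable def dataNorm (y : Vec n) : ℝ := √(y ⬝ᵥ y)

lemma dataNorm_actData (g : TransGroup n) (y : Vec n) :
    dataNorm (actData g y) = g.1.1 * dataNorm y := by
  rw [dataNorm, actData_dotProduct_self, Real.sqrt_mul (sq_nonneg _), Real.sqrt_sq g.1.2.le,
    dataNorm]

lemma dataNorm_pos {y : Vec n} (hy : y ≠ 0) : 0 < dataNorm y :=
  Real.sqrt_pos.2 (lt_of_le_of_ne (Finset.sum_nonneg fun i _ => mul_self_nonneg (y i))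
    fun h => hy (dotProduct_self_eq_zero.1 h.symm))

lemma measurable_dataNorm : Measurable (dataNorm : Vec n → ℝ) := by
  unfold dataNorm dotProduct
  fun_prop

/-- The weight `x e⁻ˣ`, which is positive for `x > 0` and has total mass one for `dσ / σ`. -/
noncomputable def scaleWeight (x : ℝ) : ℝ≥0∞ := ENNReal.ofReal (x * Real.exp (-x))

lemma measurable_scaleWeight : Measurable scaleWeight := by
  unfold scaleWeight
  fun_prop

lemma scaleWeight_ne_zero {x : ℝ} (hx : 0 < x) : scaleWeight x ≠ 0 :=
  (ENNReal.ofReal_pos.2 (mul_pos hx (Real.exp_pos _))).ne'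

lemma lintegral_scaleWeight : ∫⁻ a, scaleWeight a.1 ∂scalePrior = 1 := by
  rw [lintegral_scalePrior]
  have h : ∀ x ∈ Set.Ioi (0 : ℝ),
      ENNReal.ofReal x⁻¹ * scaleWeight x = ENNReal.ofReal (Real.exp (-x)) := by
    intro x hx
    have hx : 0 < x := hx
    rw [scaleWeight, ← ENNReal.ofReal_mul (inv_nonneg.2 hx.le), inv_mul_cancel_left₀ hx.ne']
  rw [setLIntegral_congr_fun measurableSet_Ioi h, ← ofReal_integral_eq_lintegral_ofReal
    (by simpa [IntegrableOn] using exp_neg_integrableOn_Ioi 0 one_pos)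
    (Filter.Eventually.of_forall fun x => (Real.exp_pos _).le),
    integral_exp_neg_Ioi_zero, ENNReal.ofReal_one]

/-- Since `dσ / σ` is scale invariant, the total mass stays one after any rescaling. -/
lemma lintegral_scaleWeight_mul {c : ℝ} (hc : 0 < c) :
    ∫⁻ a, scaleWeight (a.1 * c) ∂scalePrior = 1 := by
  rw [← lintegral_scaleWeight, ← lintegral_mul_scalePrior ⟨c, hc⟩ _ measurable_scaleWeight]
  simp only [Positive.val_mul, mul_comm]

/-! ### Bayes loss and risk -/

section Risk

variable {D : Type*} [MeasurableSpace D] {L : D → Param n r → ℝ≥0∞}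

lemma measurable_loss_density (s : Vec r) (hL : Measurable (Function.uncurry L))
    {δ : Vec n → D} (hδ : Measurable δ) :
    Measurable (Function.uncurry fun θ y => L (δ y) θ * density s θ y) :=
  (hL.comp ((hδ.comp measurable_snd).prodMk measurable_fst)).mul (measurable_density s)

instance instSFiniteInvariantPrior (hrn : ∀ k, r k ≤ n k) : SFinite (invariantPrior hrn) := by
  unfold invariantPrior
  infer_instance

lemma measurable_bayesLoss (hrn : ∀ k, r k ≤ n k) (s : Vec r)
    (hL : Measurable (Function.uncurry L)) {δ : Vec n → D} (hδ : Measurable δ) :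
    Measurable fun y => bayesLoss hrn s L y (δ y) :=
  (measurable_loss_density s hL hδ).lintegral_prod_left'

/-- The Bayes loss is relatively invariant: by invariance of the loss and of the prior, only the
Jacobian factor of the density remains. -/
lemma bayesLoss_smul [MulAction (TransGroup n) D] (hrn : ∀ k, r k ≤ n k) (s : Vec r)
    (hL : Measurable (Function.uncurry L))
    (hinv : ∀ (g : TransGroup n) (d : D) (θ : Param n r), L (g • d) (actParam g θ) = L d θ)
    (g : TransGroup n) (y : Vec n) (d : D) :
    bayesLoss hrn s L (actData g y) (g • d)
      = ENNReal.ofReal ((g.1.1 ^ Fintype.card (∀ k, Fin (n k)))⁻¹) * bayesLoss hrn s L y d := by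
  have hmeas (y : Vec n) (d : D) : Measurable fun θ : Param n r => L d θ * density s θ y :=
    hL.of_uncurry_left.mul (measurable_density s).of_uncurry_right
  unfold bayesLoss
  rw [← lintegral_const_mul _ (hmeas y d), ← map_actParam_invariantPrior hrn g,
    lintegral_map (hmeas _ _) (measurable_actParam g), map_actParam_invariantPrior]
  simp only [hinv, density_actData, mul_left_comm]

lemma ae_ne_zero [Nonempty (∀ k, Fin (n k))] : ∀ᵐ y : Vec n, y ≠ 0 :=
  compl_mem_ae_iff.2 (measure_singleton 0)

/-- The change of variables `y = g z`: the Jacobian `a ^ n` cancels the factor that the density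
picks up, and the weight is the only term that is not invariant. -/
lemma lintegral_weight_loss_actParam [MulAction (TransGroup n) D]
    [Nonempty (∀ k, Fin (n k))] (s : Vec r) (hL : Measurable (Function.uncurry L))
    (hinv : ∀ (g : TransGroup n) (d : D) (θ : Param n r), L (g • d) (actParam g θ) = L d θ)
    {δ : Vec n → D} (hδ : Measurable δ) (heq : Equivariant δ) (g : TransGroup n)
    (θ : Param n r) :
    ∫⁻ y, L (δ y) (actParam g θ) * density s (actParam g θ) y * scaleWeight (dataNorm y)
      = ∫⁻ y, L (δ y) θ * density s θ y * scaleWeight (g.1.1 * dataNorm y) := by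
  have ha := g.1.2
  have hmeas (θ : Param n r) : Measurable fun y => L (δ y) θ * density s θ y :=
    (measurable_loss_density s hL hδ).of_uncurry_left
  -- Lebesgue measure is written as a multiple of its image under the action of `g`.
  have hvol : (volume : Measure (Vec n)) = ENNReal.ofReal (g.1.1 ^ Fintype.card (∀ k, Fin (n k))) •
      (volume : Measure (Vec n)).map (actData g) := by
    rw [map_actData_volume, smul_smul, ← ENNReal.ofReal_mul (by positivity),
      mul_inv_cancel₀ (by positivity), ENNReal.ofReal_one, one_smul]
  conv_lhs => rw [hvol]
  have hw : Measurable fun y : Vec n => scaleWeight (dataNorm y) :=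
    measurable_scaleWeight.comp measurable_dataNorm
  have hmw : Measurable fun y =>
      L (δ y) (actParam g θ) * density s (actParam g θ) y * scaleWeight (dataNorm y) :=
    (hmeas _).mul hw
  rw [lintegral_smul_measure, lintegral_map hmw (measurable_actData g), smul_eq_mul,
    ← lintegral_const_mul]
  · refine lintegral_congr_ae ?_
    filter_upwards [ae_ne_zero (n := n)] with y hy
    rw [heq g y hy, hinv, density_actData, dataNorm_actData]
    have h : ENNReal.ofReal (g.1.1 ^ Fintype.card (∀ k, Fin (n k))) *
        ENNReal.ofReal ((g.1.1 ^ Fintype.card (∀ k, Fin (n k)))⁻¹) = 1 := by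
      rw [← ENNReal.ofReal_mul (by positivity), mul_inv_cancel₀ (by positivity),
        ENNReal.ofReal_one]
    calc _ = (ENNReal.ofReal (g.1.1 ^ Fintype.card (∀ k, Fin (n k))) *
        ENNReal.ofReal ((g.1.1 ^ Fintype.card (∀ k, Fin (n k)))⁻¹)) *
          (L (δ y) θ * density s θ y * scaleWeight (g.1.1 * dataNorm y)) := by ring
      _ = _ := by rw [h, one_mul]
  · exact hmw.comp (measurable_actData g)

lemma risk_eq_lintegral_density (s : Vec r) (hL : Measurable (Function.uncurry L))
    {δ : Vec n → D} (hδ : Measurable δ) (θ : Param n r) :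
    risk s L δ θ = ∫⁻ y, L (δ y) θ * density s θ y := by
  have hd : Measurable (density (n := n) s θ) := (measurable_density s).of_uncurry_left
  have hLθ : Measurable fun y => L (δ y) θ := hL.of_uncurry_right.comp hδ
  rw [risk, dataLaw_eq_withDensity, lintegral_withDensity_eq_lintegral_mul _ hd hLθ]
  simp only [Pi.mul_apply, mul_comm]

/-- The risk of an equivariant rule, at any parameter value, is its weighted integrated Bayes
loss. After exchanging the integrals over `y` and over the parameter `g θ`, the change of variables
`y = g z` leaves `g` in the weight only, where just its scale matters, and the weight then
integrates to one. -/
lemma lintegral_bayesLoss_eq_risk [MulAction (TransGroup n) D] [Nonempty (∀ k, Fin (n k))]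
    (hrn : ∀ k, r k ≤ n k) (s : Vec r) (hL : Measurable (Function.uncurry L))
    (hinv : ∀ (g : TransGroup n) (d : D) (θ : Param n r), L (g • d) (actParam g θ) = L d θ)
    {δ : Vec n → D} (hδ : Measurable δ) (heq : Equivariant δ) (θ : Param n r) :
    ∫⁻ y, bayesLoss hrn s L y (δ y) * scaleWeight (dataNorm y) = risk s L δ θ := by
  have hw : Measurable fun y : Vec n => scaleWeight (dataNorm y) :=
    measurable_scaleWeight.comp measurable_dataNorm
  have hld := measurable_loss_density s hL hδ
  have hmeas : Measurable (Function.uncurry fun θ y =>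
      L (δ y) θ * density s θ y * scaleWeight (dataNorm y)) :=
    hld.mul (hw.comp measurable_snd)
  have hmeasθ : Measurable fun y => L (δ y) θ * density s θ y :=
    hld.of_uncurry_left
  have hscale (a : {σ : ℝ // 0 < σ}) (U : factorSet n r) :
      ∫⁻ y, L (δ y) (a, U) * density s (a, U) y * scaleWeight (dataNorm y)
        = ∫⁻ y, L (δ y) θ * density s θ y * scaleWeight (a.1 * (θ.1.1⁻¹ * dataNorm y)) := by
    obtain ⟨g, hg, hgθ⟩ := exists_actParam_eq θ (a, U)
    have hg' : g.1.1 = a.1 * θ.1.1⁻¹ := congrArg Subtype.val hg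
    rw [← hgθ, lintegral_weight_loss_actParam s hL hinv hδ heq g θ, hg']
    simp only [mul_assoc]
  calc ∫⁻ y, bayesLoss hrn s L y (δ y) * scaleWeight (dataNorm y)
      = ∫⁻ y, ∫⁻ θ', L (δ y) θ' * density s θ' y * scaleWeight (dataNorm y)
          ∂(invariantPrior hrn) := by
        refine lintegral_congr fun y => ?_
        rw [lintegral_mul_const]
        · rfl
        · exact hld.of_uncurry_right
    _ = ∫⁻ θ', (∫⁻ y, L (δ y) θ' * density s θ' y * scaleWeight (dataNorm y))
          ∂(invariantPrior hrn) :=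
        (lintegral_lintegral_swap hmeas.aemeasurable).symm
    _ = ∫⁻ a, (∫⁻ y, L (δ y) θ * density s θ y * scaleWeight (a.1 * (θ.1.1⁻¹ * dataNorm y)))
          ∂scalePrior := by
        have hint : Measurable fun θ' =>
            ∫⁻ y, L (δ y) θ' * density s θ' y * scaleWeight (dataNorm y) :=
          hmeas.lintegral_prod_right'
        rw [invariantPrior, lintegral_prod _ hint.aemeasurable]
        simp only [hscale, lintegral_const, measure_univ, mul_one]
    _ = ∫⁻ y, ∫⁻ a, L (δ y) θ * density s θ y * scaleWeight (a.1 * (θ.1.1⁻¹ * dataNorm y))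
          ∂scalePrior := by
        refine lintegral_lintegral_swap (Measurable.aemeasurable ?_)
        refine (hmeasθ.comp measurable_snd).mul (measurable_scaleWeight.comp ?_)
        exact (measurable_subtype_coe.comp measurable_fst).mul
          ((measurable_dataNorm.comp measurable_snd).const_mul _)
    _ = ∫⁻ y, L (δ y) θ * density s θ y := by
        refine lintegral_congr_ae ?_
        filter_upwards [ae_ne_zero (n := n)] with y hy
        rw [lintegral_const_mul,
          lintegral_scaleWeight_mul (mul_pos (inv_pos.2 θ.1.2) (dataNorm_pos hy)), mul_one]
        exact measurable_scaleWeight.comp (measurable_subtype_coe.mul_const _)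
    _ = risk s L δ θ := (risk_eq_lintegral_density s hL hδ θ).symm

lemma isMinRiskEquivariant_of_ae_minimizer [MulAction (TransGroup n) D]
    [Nonempty (∀ k, Fin (n k))] (hrn : ∀ k, r k ≤ n k) (s : Vec r)
    (hL : Measurable (Function.uncurry L))
    (hinv : ∀ (g : TransGroup n) (d : D) (θ : Param n r), L (g • d) (actParam g θ) = L d θ)
    {δ : Vec n → D} (hδ : Measurable δ) (heq : Equivariant δ)
    (hmin : ∀ᵐ y, ∀ d, bayesLoss hrn s L y (δ y) ≤ bayesLoss hrn s L y d) :
    IsMinRiskEquivariant s L δ := by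
  refine ⟨hδ, heq, fun δ' hδ' heq' θ => ?_⟩
  rw [← lintegral_bayesLoss_eq_risk hrn s hL hinv hδ heq,
    ← lintegral_bayesLoss_eq_risk hrn s hL hinv hδ' heq']
  exact lintegral_mono_ae (hmin.mono fun y hy => mul_le_mul_left (hy _) _)

/-- Both rules have minimum risk, so their weighted Bayes losses have the same finite integral; as
that of `δ` is almost everywhere the smaller one, the two agree almost everywhere. -/
lemma ae_bayesLoss_eq_of_isMinRiskEquivariant [MulAction (TransGroup n) D]
    [Nonempty (∀ k, Fin (n k))] (hrn : ∀ k, r k ≤ n k) (s : Vec r)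
    (hL : Measurable (Function.uncurry L))
    (hinv : ∀ (g : TransGroup n) (d : D) (θ : Param n r), L (g • d) (actParam g θ) = L d θ)
    {δ δ' : Vec n → D} (hδ : Measurable δ) (heq : Equivariant δ)
    (hmin : ∀ᵐ y, ∀ d, bayesLoss hrn s L y (δ y) ≤ bayesLoss hrn s L y d)
    (hδ' : IsMinRiskEquivariant s L δ') (hfin : ∃ θ, risk s L δ' θ ≠ ∞) :
    ∀ᵐ y, bayesLoss hrn s L y (δ' y) = bayesLoss hrn s L y (δ y) := by
  obtain ⟨θ, hθ⟩ := hfin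
  have hle := hδ'.2.2 δ hδ heq θ
  have hle' := (isMinRiskEquivariant_of_ae_minimizer hrn s hL hinv hδ heq hmin).2.2
    δ' hδ'.1 hδ'.2.1 θ
  rw [← lintegral_bayesLoss_eq_risk hrn s hL hinv hδ heq] at hle hle'
  rw [← lintegral_bayesLoss_eq_risk hrn s hL hinv hδ'.1 hδ'.2.1] at hle hle' hθ
  have h := ae_eq_of_ae_le_of_lintegral_le
    (hmin.mono fun y hy => mul_le_mul_left (hy (δ' y)) (scaleWeight (dataNorm y)))
    (ne_top_of_le_ne_top hθ hle')
    ((measurable_bayesLoss hrn s hL hδ'.1).mul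
      (measurable_scaleWeight.comp measurable_dataNorm)).aemeasurable hle
  filter_upwards [h, ae_ne_zero (n := n)] with y hy hy0
  exact ((ENNReal.mul_left_inj (scaleWeight_ne_zero (dataNorm_pos hy0))
    ENNReal.ofReal_ne_top).1 hy).symm

lemma equivariant_of_unique_minimizer [MulAction (TransGroup n) D]
    (hrn : ∀ k, r k ≤ n k) (s : Vec r) (hL : Measurable (Function.uncurry L))
    (hinv : ∀ (g : TransGroup n) (d : D) (θ : Param n r), L (g • d) (actParam g θ) = L d θ)
    {δ : Vec n → D}
    (hmin : ∀ y, y ≠ 0 → ∀ d, d ≠ δ y → bayesLoss hrn s L y (δ y) < bayesLoss hrn s L y d) :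
    Equivariant δ := by
  intro g y hy
  by_contra hne
  -- If `δ (g y)` differed from `g δ(y)`, each would beat the other, at `g y` and at `y`.
  have h := hmin _ (actData_ne_zero g hy) (g • δ y) (Ne.symm hne)
  have h' := hmin y hy (g⁻¹ • δ (actData g y)) fun h => hne (by rw [← h, smul_inv_smul])
  rw [← smul_inv_smul g (δ (actData g y)), bayesLoss_smul hrn s hL hinv,
    bayesLoss_smul hrn s hL hinv] at h
  exact (lt_of_mul_lt_mul_left' h).not_gt h'

end Risk

end Tucker

theorem proposition1 {K : ℕ} (n r : Fin K → ℕ) (hr : ∀ k, 1 ≤ r k) (hrn : ∀ k, r k ≤ n k)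
    (s : Tucker.Vec r)
    {D : Type*} [MeasurableSpace D] [MulAction (Tucker.TransGroup n) D]
    (L : D → Tucker.Param n r → ℝ≥0∞) (hL : Measurable (Function.uncurry L))
    (hinv : ∀ (g : Tucker.TransGroup n) (d : D) (θ : Tucker.Param n r),
      L (g • d) (Tucker.actParam g θ) = L d θ) :
    -- the generalized Bayes rule, when it is unique, is equivariant, has minimum risk,
    -- and is the only minimum risk equivariant rule up to null sets
    (∀ δ : Tucker.Vec n → D,
      (∀ y, y ≠ 0 → ∀ d, d ≠ δ y →
        Tucker.bayesLoss hrn s L y (δ y) < Tucker.bayesLoss hrn s L y d) →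
      Tucker.Equivariant δ ∧
      (Measurable δ → Tucker.IsMinRiskEquivariant s L δ ∧
        ∀ δ' : Tucker.Vec n → D, Tucker.IsMinRiskEquivariant s L δ' →
          (∃ θ, Tucker.risk s L δ' θ ≠ ∞) → δ' =ᵐ[volume] δ)) ∧
    -- every equivariant rule given by a minimizer, unique or not, is a minimum risk
    -- equivariant rule
    (∀ δ : Tucker.Vec n → D, Measurable δ → Tucker.Equivariant δ →
      (∀ᵐ y, ∀ d, Tucker.bayesLoss hrn s L y (δ y) ≤ Tucker.bayesLoss hrn s L y d) →
      Tucker.IsMinRiskEquivariant s L δ) ∧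
    -- conversely, if there is such a rule, every minimum risk equivariant rule of finite risk
    -- is given by a minimizer
    (∀ δ δ' : Tucker.Vec n → D, Measurable δ → Tucker.Equivariant δ →
      (∀ᵐ y, ∀ d, Tucker.bayesLoss hrn s L y (δ y) ≤ Tucker.bayesLoss hrn s L y d) →
      Tucker.IsMinRiskEquivariant s L δ' → (∃ θ, Tucker.risk s L δ' θ ≠ ∞) →
      ∀ᵐ y, ∀ d, Tucker.bayesLoss hrn s L y (δ' y) ≤ Tucker.bayesLoss hrn s L y d) := by
  have hne : Nonempty (∀ k, Fin (n k)) := ⟨fun k => ⟨0, (hr k).trans (hrn k)⟩⟩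
  refine ⟨fun δ hmin => ?_, fun δ hδ heq hmin =>
    Tucker.isMinRiskEquivariant_of_ae_minimizer hrn s hL hinv hδ heq hmin,
    fun δ δ' hδ heq hmin hδ' hfin => ?_⟩
  · have heq := Tucker.equivariant_of_unique_minimizer hrn s hL hinv hmin
    refine ⟨heq, fun hδ => ?_⟩
    have hmin' : ∀ᵐ y, ∀ d,
        Tucker.bayesLoss hrn s L y (δ y) ≤ Tucker.bayesLoss hrn s L y d := by
      filter_upwards [Tucker.ae_ne_zero (n := n)] with y hy d
      obtain rfl | hd := eq_or_ne d (δ y)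
      · exact le_rfl
      · exact (hmin y hy d hd).le
    refine ⟨Tucker.isMinRiskEquivariant_of_ae_minimizer hrn s hL hinv hδ heq hmin',
      fun δ' hδ' hfin => ?_⟩
    filter_upwards [Tucker.ae_bayesLoss_eq_of_isMinRiskEquivariant hrn s hL hinv hδ heq hmin'
      hδ' hfin, Tucker.ae_ne_zero (n := n)] with y hy hy0
    by_contra hd
    exact (hmin y hy0 _ hd).ne' hy
  · filter_upwards [Tucker.ae_bayesLoss_eq_of_isMinRiskEquivariant hrn s hL hinv hδ heq hmin
      hδ' hfin, hmin] with y hy hy' d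
    exact hy.trans_le (hy' d)
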